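/- Let $r \ge 2$ be a fixed integer and let $\mathrm{UT}_r(\mathbb{Z})$ be the group of upper triangular $r \times r$ integer matrices with $1$'s on the diagonal. For $1 \le i < j \le r$ let $E_{i,j}$ be the elementary matrix obtained from the identity matrix by putting a $1$ in position $(i,j)$, and let $X$ be the finite set of all these matrices and their inverses. A word $w \in X^*$ represents the matrix $\overline{w} \in \mathrm{UT}_r(\mathbb{Z})$, the product of its letters. Theorem. The sequence $$E_{1,2},\, E_{2,3},\, \dots,\, E_{r-1,r},\; E_{1,3},\, E_{2,4},\, \dots,\, E_{r-2,r},\; \dots,\; E_{1,r}$$ (one superdiagonal after the other, each from top to bottom) is a polycyclic generating sequence of $\mathrm{UT}_r(\mathbb{Z})$: writing it as $a_1,\dots,a_m$ and putting $G_k = \langle a_k,\dots,a_m\rangle$, we have $G_1=\mathrm{UT}_r(\mathbb{Z})$, and $G_{k+1}$ is normal in $G_k$ for $1 \le k \le m$ (where $G_{m+1}$ is trivial). The set $L \subset X^*$ of all words $a_1^{e_1} a_2^{e_2} \cdots a_m^{e_m}$ with $e_1,\dots,e_m \in \mathbb{Z}$ is a normal form, that is, $w \mapsto \overline{w}$ restricts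 to a bijection from $L$ onto $\mathrm{UT}_r(\mathbb{Z})$. The function $g_X : X^* \to X^*$ that sends a word $w$ to the unique word $g_X(w) \in L$ with $\overline{g_X(w)} = \overline{w}$ is computable in logspace: there are a constant $c$ and a deterministic Turing machine with a read-only input tape, one read-write work tape and a write-only output tape which, on every input word $w \in X^*$, halts with $g_X(w)$ on its output tape and uses at most $c(\lfloor \log_2 n\rfloor + 1)$ squares of its work tape, where $n$ is the length of $w$ (and $\lfloor\log_2 0\rfloor$ is read as $0$). The machine and $c$ may depend on $r$, but not on $w$. -/

import Mathlib

/-! ### Deterministic logspace transducers -/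

/-- What the head sees on the read-only input tape: a letter of the input word, or one of the two
end markers delimiting it. -/
inductive InputSymbol (A : Type) : Type
  | leftEnd : InputSymbol A
  | letter (a : A) : InputSymbol A
  | rightEnd : InputSymbol A

/-- A move of a tape head. -/
inductive HeadMove : Type
  | left : HeadMove
  | stay : HeadMove
  | right : HeadMove

/-- The effect of a move on a head position; moving left from position `0` has no effect. -/
def HeadMove.apply : HeadMove → ℕ → ℕ
  | .left, p => p - 1
  | .stay, p => p
  | .right, p => p + 1

/-- What a transducer does in one transition. -/
structure TransducerAction (B Q Γ : Type) : Type where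
  /-- the new state -/
  state : Q
  /-- the symbol written on the scanned square of the work tape -/
  write : Γ
  /-- the move of the head on the input tape -/
  inputMove : HeadMove
  /-- the move of the head on the work tape -/
  workMove : HeadMove
  /-- the letters appended to the output tape (possibly none) -/
  output : List B

/-- A deterministic transducer with a finite state control, a read-only input tape over the finite
alphabet `A`, one read-write work tape, and a write-only output tape over the finite alphabet `B`.
The table `δ` says what to do, given the state, the scanned input symbol and the scanned work
symbol; the value `none` means that the machine halts. The table is finite, so the number of letters
written in one transition is bounded. -/
structure Transducer (A B : Type) [Finite A] [Finite B] : Type 1 where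
  /-- the states -/
  Q : Type
  /-- the work alphabet -/
  Γ : Type
  [finiteQ : Finite Q]
  [finiteΓ : Finite Γ]
  /-- the initial state -/
  start : Q
  /-- the blank symbol of the work tape -/
  blank : Γ
  /-- the transition table -/
  δ : Q → InputSymbol A → Γ → Option (TransducerAction B Q Γ)

namespace Transducer

variable {A B : Type} [Finite A] [Finite B]

/-- A configuration. Position `0` of the input tape is the left end marker, positions `1, …, n` hold
the letters of the input word, and position `n + 1` is the right end marker. The squares of the work
tape are numbered `0, 1, 2, …`. -/
structure Cfg (T : Transducer A B) : Type where
  /-- the state -/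
  state : T.Q
  /-- the position of the input head -/
  inputPos : ℕ
  /-- the content of the work tape -/
  work : ℕ → T.Γ
  /-- the position of the work head -/
  workPos : ℕ
  /-- the word on the output tape -/
  out : List B

/-- The symbol at position `p` of the input tape that holds the word `w`. -/
def inputAt (w : List A) : ℕ → InputSymbol A
  | 0 => .leftEnd
  | p + 1 => match w[p]? with
    | some a => .letter a
    | none => .rightEnd

/-- The initial configuration: blank work tape, empty output, both heads at the left ends. -/
def init (T : Transducer A B) : T.Cfg where
  state := T.start
  inputPos := 0
  work := fun _ => T.blank
  workPos := 0
  out := []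

/-- One step on input `w`; the value is `none` when the machine has halted. The input head never
leaves the region between the two end markers. -/
def step (T : Transducer A B) (w : List A) (c : T.Cfg) : Option T.Cfg :=
  (T.δ c.state (inputAt w c.inputPos) (c.work c.workPos)).map fun a =>
    { state := a.state
      inputPos := min (a.inputMove.apply c.inputPos) (w.length + 1)
      work := Function.update c.work c.workPos a.write
      workPos := a.workMove.apply c.workPos
      out := c.out ++ a.output }

/-- `c` is reached by the computation on input `w`. -/
def Reaches (T : Transducer A B) (w : List A) (c : T.Cfg) : Prop :=
  StateTransition.Reaches (T.step w) T.init c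

/-- On input `w`, the machine halts with `v` on its output tape, and throughout the computation its
work head stays on the first `s` squares of the work tape. -/
def ComputesInSpace (T : Transducer A B) (w : List A) (v : List B) (s : ℕ) : Prop :=
  (∃ c : T.Cfg, T.Reaches w c ∧ T.step w c = none ∧ c.out = v) ∧
    ∀ c : T.Cfg, T.Reaches w c → c.workPos < s

end Transducer

/-- `f` is computed by a deterministic transducer that uses at most `c * (⌊log₂ n⌋ + 1)` squares of
its work tape on every input of length `n`, for a constant `c`. (The `+ 1` only gives meaning to the
bound for `n ≤ 1`: for `n ≥ 2` the bound is at most `2 * c * log₂ n`.) -/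
def LogspaceComputable {A B : Type} [Finite A] [Finite B] (f : List A → List B) : Prop :=
  ∃ (T : Transducer A B) (c : ℕ), ∀ w : List A,
    T.ComputesInSpace w (f w) (c * (Nat.log 2 w.length + 1))

/-! ### Words and normal forms -/

/-- The group element represented by a word over an alphabet `X` whose letters stand for the
elements `val x`. -/
def wordEval {X G : Type} [Group G] (val : X → G) (w : List X) : G :=
  (w.map val).prod

/-- A normal form: a set of words in bijection with the group under evaluation. -/
def IsNormalForm {X G : Type} [Group G] (val : X → G) (L : Set (List X)) : Prop :=
  Set.BijOn (wordEval val) L Set.univ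

/-- `g` sends every word to the word in `L` that represents the same group element. -/
def IsNormalFormFunction {X G : Type} [Group G] (val : X → G) (L : Set (List X))
    (g : List X → List X) : Prop :=
  ∀ w : List X, g w ∈ L ∧ wordEval val (g w) = wordEval val w

/-- A polycyclic generating sequence `a₁, …, aₘ` of `G`: the subgroups `Gₖ = ⟨aₖ, …, aₘ⟩` satisfy
`G₁ = G`, and each `Gₖ₊₁` is normal in `Gₖ` (the quotient is then cyclic, generated by `aₖ`). -/
def IsPolycyclicGeneratingSequence {G : Type} [Group G] (a : List G) : Prop :=
  Subgroup.closure {g | g ∈ a} = ⊤ ∧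
    ∀ k < a.length,
      ((Subgroup.closure {g | g ∈ a.drop (k + 1)}).subgroupOf
        (Subgroup.closure {g | g ∈ a.drop k})).Normal

/-! ### Unitriangular integer matrices -/

/-- The group of upper triangular `r × r` integer matrices with all diagonal entries `1`. -/
def UT (r : ℕ) : Subgroup (Matrix.SpecialLinearGroup (Fin r) ℤ) where
  carrier := {A | A.1.BlockTriangular id ∧ ∀ i, A.1 i i = 1}
  one_mem' := ⟨Matrix.blockTriangular_one, fun i => by simp⟩
  mul_mem' := by
    rintro A B ⟨hA, hA1⟩ ⟨hB, hB1⟩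
    refine ⟨hA.mul hB, fun i => ?_⟩
    have h : (A.1 * B.1) i i = A.1 i i * B.1 i i := by
      rw [Matrix.mul_apply]
      refine Finset.sum_eq_single i (fun j _ hj => ?_) (by simp)
      rcases lt_or_gt_of_ne hj with h | h
      · rw [hA h, zero_mul]
      · rw [hB h, mul_zero]
    exact h.trans (by rw [hA1, hB1, one_mul])
  inv_mem' := by
    rintro A ⟨hA, hA1⟩
    have hinv : (A⁻¹).1 = (A.1)⁻¹ := by
      refine (Matrix.inv_eq_left_inv ?_).symm
      exact congrArg Subtype.val (inv_mul_cancel A)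
    have : Invertible A.1 := Matrix.invertibleOfIsUnitDet A.1 (by rw [A.2]; exact isUnit_one)
    have hB : (A⁻¹).1.BlockTriangular id := by
      rw [hinv]; exact Matrix.blockTriangular_inv_of_blockTriangular hA
    refine ⟨hB, fun i => ?_⟩
    have h : (A.1 * (A⁻¹).1) i i = A.1 i i * (A⁻¹).1 i i := by
      rw [Matrix.mul_apply]
      refine Finset.sum_eq_single i (fun j _ hj => ?_) (by simp)
      rcases lt_or_gt_of_ne hj with h | h
      · rw [hA h, zero_mul]
      · rw [hB h, mul_zero]
    have h1 : A.1 * (A⁻¹).1 = 1 := congrArg Subtype.val (mul_inv_cancel A)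
    rw [h1, hA1, one_mul, Matrix.one_apply_eq] at h
    exact h.symm

/-- The index pairs `(i, j)` with `i < j`, that is, the positions above the diagonal. -/
abbrev UpperPos (r : ℕ) : Type := {p : Fin r × Fin r // p.1 < p.2}

/-- The elementary matrix `E_{i,j}`: the identity matrix with an additional `1` in position
`(i, j)`. -/
def elemMatrix {r : ℕ} (p : UpperPos r) : UT r :=
  ⟨Matrix.SpecialLinearGroup.transvection p.2.ne 1,
    Matrix.blockTriangular_transvection p.2.le 1, fun i => by
      have h : ¬(p.1.1 = i ∧ p.1.2 = i) := fun h => p.2.ne (h.1.trans h.2.symm)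
      simp [Matrix.SpecialLinearGroup.transvection, Matrix.transvection, h]⟩

/-- The symmetric generating alphabet: `(p, true)` stands for the elementary matrix at `p`, and
`(p, false)` for its inverse. -/
abbrev UTLetter (r : ℕ) : Type := UpperPos r × Bool

/-- The matrix that a letter stands for. -/
def letterVal {r : ℕ} (x : UTLetter r) : UT r :=
  if x.2 then elemMatrix x.1 else (elemMatrix x.1)⁻¹

/-- The positions above the diagonal, one superdiagonal after the other, each from top to bottom:
`(1,2), (2,3), …, (r-1,r), (1,3), (2,4), …, (r-2,r), …, (1,r)` (in one-based numbering). -/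
def pcPositions (r : ℕ) : List (UpperPos r) :=
  (List.range r).flatMap fun d =>
    (List.finRange r).filterMap fun i =>
      if h : 0 < d ∧ i.1 + d < r then
        some ⟨(i, ⟨i.1 + d, h.2⟩), Fin.lt_def.mpr (Nat.lt_add_of_pos_right h.1)⟩
      else none

/-- The word `E_p ^ e`: `|e|` copies of the letter for `E_p` or, if `e < 0`, for its inverse. -/
def powerWord {r : ℕ} (p : UpperPos r) (e : ℤ) : List (UTLetter r) :=
  List.replicate e.natAbs (p, decide (0 ≤ e))

/-- The word `E_{1,2}^{e_{1,2}} E_{2,3}^{e_{2,3}} ⋯ E_{1,r}^{e_{1,r}}`. -/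
def pcWord {r : ℕ} (e : UpperPos r → ℤ) : List (UTLetter r) :=
  (pcPositions r).flatMap fun p => powerWord p (e p)

/-- The words `E_{1,2}^{e_{1,2}} E_{2,3}^{e_{2,3}} ⋯ E_{1,r}^{e_{1,r}}` with integer exponents. -/
def pcNormalForm (r : ℕ) : Set (List (UTLetter r)) :=
  Set.range pcWord

/-! Order the positions above the diagonal by superdiagonal, then from top to bottom. If `M`
vanishes at all positions before `p = (i, j)`, the entries at `p` add up in `M * N` (`entry_mul`),
since a mixed term with `i < k < j` contains the entry of `M` at `(i, k)`, on an earlier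
superdiagonal. Hence the matrices vanishing on an initial segment of positions form a subgroup, the
next entry is a homomorphism from it to `ℤ`, and its kernel is the next subgroup. These subgroups
are the `G_k` (`closure_elemMatrix_eq`). Clearing the entries in order by powers of elementary
matrices from the left, and recording the exponents, spells the normal form (`clearingWord`).

For the space bound, the entries of a product of `n` letters are polynomial in `n`
(`abs_wordEval_apply_le`). Clearing a position takes as many letters as the absolute value of its
entry, and the number of positions is fixed, so all matrices that occur are products of polynomially
many letters and their entries have `O(log n)` digits. Every letter acts as a row or column
operation, so integer registers with sign tests and signed additions suffice (`clearingTransducer`);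
each unit step of a clearing writes one output letter, so no exponent has to be stored. A Turing
machine simulates the registers on parallel tracks in balanced ternary (`toTransducer`): negative
numbers need no special treatment, and one sweep carries out an update and finds the new signs. -/

/-! ### Halting in bounded space -/

namespace Transducer

variable {A B : Type} [Finite A] [Finite B]

/-- Started in the given configuration, the machine halts with `v` on its output tape, and its work
head stays on the first `s` squares. -/
inductive HaltsFrom (T : Transducer A B) (w : List A) (v : List B) (s : ℕ) : T.Cfg → Prop
  | halt (c : T.Cfg) (h : T.step w c = none) (hv : c.out = v) (hs : c.workPos < s) :
      HaltsFrom T w v s c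
  | step (c c' : T.Cfg) (h : T.step w c = some c') (hs : c.workPos < s)
      (h' : HaltsFrom T w v s c') : HaltsFrom T w v s c

/-- The machine is deterministic, so the single run recorded by the inductive predicate passes
through every reachable configuration. -/
theorem HaltsFrom.computesInSpace {T : Transducer A B} {w : List A} {v : List B} {s : ℕ}
    (h : T.HaltsFrom w v s T.init) : T.ComputesInSpace w v s := by
  have key : ∀ c, T.HaltsFrom w v s c →
      (∃ d, StateTransition.Reaches (T.step w) c d ∧ T.step w d = none ∧ d.out = v) ∧
        ∀ d, StateTransition.Reaches (T.step w) c d → d.workPos < s := by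
    intro c hc
    induction hc with
    | halt c h hv hs =>
      refine ⟨⟨c, Relation.ReflTransGen.refl, h, hv⟩, fun d hd => ?_⟩
      rcases Relation.ReflTransGen.cases_head hd with rfl | ⟨e, he, -⟩
      · exact hs
      · simp [h] at he
    | step c c' h hs _ ih =>
      obtain ⟨⟨d, hd, hd'⟩, hall⟩ := ih
      refine ⟨⟨d, Relation.ReflTransGen.head h hd, hd'⟩, fun d hd => ?_⟩
      rcases Relation.ReflTransGen.cases_head hd with rfl | ⟨e, he, hed⟩
      · exact hs
      · obtain rfl : c' = e := by simpa [h] using he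
        exact hall d hed
  exact key _ h

end Transducer

/-! ### Balanced ternary digits -/

/-- The last balanced ternary digit of an integer. -/
noncomputable def ternaryDigit (t : ℤ) : SignType := SignType.sign (t.bmod 3)

/-- The carry that an integer of absolute value at most `3` leaves for the next balanced ternary
digit. -/
noncomputable def ternaryCarry (t : ℤ) : SignType := SignType.sign (t - t.bmod 3)

/-- The bound 3 is what a digit, a signed digit and an incoming carry can add up to; the outgoing
carry is then again in `{-1, 0, 1}` and fits in the finite control. -/
theorem ternaryDigit_add_ternaryCarry {t : ℤ} (h : |t| ≤ 3) :
    (ternaryDigit t : ℤ) + 3 * ternaryCarry t = t := by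
  obtain ⟨h1, h2⟩ := abs_le.1 h
  interval_cases t <;> decide

theorem SignType.abs_cast_le_one (s : SignType) : |(s : ℤ)| ≤ 1 := by
  cases s <;> decide

/-- The extreme case is all digits equal to 1, with sum `(3 ^ p - 1) / 2`. -/
theorem two_mul_abs_sum_ternary_lt (d : ℕ → ℤ) (hd : ∀ j, |d j| ≤ 1) (p : ℕ) :
    2 * |∑ j ∈ Finset.range p, 3 ^ j * d j| < 3 ^ p := by
  induction p with
  | zero => simp
  | succ p ih =>
    rw [Finset.sum_range_succ, pow_succ]
    have h1 := abs_add_le (∑ j ∈ Finset.range p, 3 ^ j * d j) (3 ^ p * d p)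
    have h2 : |(3 : ℤ) ^ p * d p| ≤ 3 ^ p := by
      rw [abs_mul, abs_of_pos (by positivity : (0 : ℤ) < 3 ^ p)]
      exact mul_le_of_le_one_right (by positivity) (hd p)
    linarith

/-- The highest nonzero digit decides the sign, so a sweep from low to high digits only has to
remember the last nonzero digit seen. -/
theorem sign_add_pow_mul {S : ℤ} {p : ℕ} (hS : 2 * |S| < 3 ^ p) (d : SignType) :
    SignType.sign (S + 3 ^ p * (d : ℤ)) = if d = 0 then SignType.sign S else d := by
  have h1 := neg_abs_le S
  have h2 := le_abs_self S
  have h3 := abs_nonneg S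
  rcases SignType.trichotomy d with rfl | rfl | rfl
  · rw [sign_neg (by simp; linarith)]; rfl
  · simp
  · rw [sign_pos (by simp; linarith)]; rfl

/-! ### Register transducers -/

/-- What a register transducer does in one transition: besides changing the state, moving the input
head and producing output, it replaces every register `x i` by `x i + coeff i * x (source i)`. -/
structure RegisterAction (B C ι : Type) : Type where
  /-- the new state -/
  state : C
  /-- the coefficients of the update -/
  coeff : ι → SignType
  /-- the registers that are added or subtracted -/
  source : ι → ι
  /-- the move of the head on the input tape -/
  inputMove : HeadMove
  /-- the letters appended to the output tape -/
  output : List B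

/-- A transducer which, instead of a work tape, has finitely many integer registers; it can see
their signs, and change them by adding registers to each other or subtracting them. -/
structure RegisterTransducer (A B ι : Type) : Type 1 where
  /-- the states -/
  C : Type
  [finiteC : Finite C]
  /-- the initial state -/
  start : C
  /-- the initial values of the registers -/
  initial : ι → SignType
  /-- the transition table -/
  δ : C → InputSymbol A → (ι → SignType) → Option (RegisterAction B C ι)

/-- The values of the registers after an action. -/
def RegisterAction.update {B C ι : Type} (a : RegisterAction B C ι) (x : ι → ℤ) : ι → ℤ :=
  fun i => x i + a.coeff i * x (a.source i)

/-- The control states of the Turing machine that simulates a register transducer with states `C`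
and registers `ι`. -/
inductive SweepState (C ι : Type) : Type
  | start : SweepState C ι
  | ready (q : C) (sgn : ι → SignType) : SweepState C ι
  | sweep (q : C) (coeff : ι → SignType) (source : ι → ι) (carry sgn : ι → SignType) :
      SweepState C ι
  | back (q : C) (sgn : ι → SignType) : SweepState C ι

instance SweepState.finite (C ι : Type) [Finite C] [Finite ι] : Finite (SweepState C ι) := by
  let f : Option ((C × (ι → SignType)) ⊕ (C × (ι → SignType)) ⊕
      (C × (ι → SignType) × (ι → ι) × (ι → SignType) × (ι → SignType))) → SweepState C ι
    | none => .start
    | some (.inl (q, s)) => .ready q s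
    | some (.inr (.inl (q, s))) => .back q s
    | some (.inr (.inr (q, e, f, c, s))) => .sweep q e f c s
  refine Finite.of_surjective f fun x => ?_
  cases x with
  | start => exact ⟨none, rfl⟩
  | ready q s => exact ⟨some (.inl (q, s)), rfl⟩
  | sweep q e f c s => exact ⟨some (.inr (.inr (q, e, f, c, s))), rfl⟩
  | back q s => exact ⟨some (.inr (.inl (q, s))), rfl⟩

/-- A square of the simulating work tape: blank, or a digit for every register together with a flag
that marks the leftmost square. -/
abbrev DigitCell (ι : Type) : Type := Option (Bool × (ι → SignType))

namespace DigitCell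

variable {ι : Type}

/-- The digits of the registers on a square. -/
def digit : DigitCell ι → ι → SignType
  | none => 0
  | some (_, d) => d

/-- The flag on a square. -/
def flag : DigitCell ι → Bool
  | none => false
  | some (b, _) => b

/-- The register values represented by the first `K` squares of a tape. -/
def value (work : ℕ → DigitCell ι) (K : ℕ) (i : ι) : ℤ :=
  ∑ j ∈ Finset.range K, 3 ^ j * (digit (work j) i : ℤ)

/-- Exactly the first `k` squares of the tape are in use, where `1 ≤ k ≤ K`, and the flag marks the
leftmost square. -/
structure WellFormed (K k : ℕ) (work : ℕ → DigitCell ι) : Prop where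
  pos : 1 ≤ k
  le : k ≤ K
  eq_none_iff : ∀ p, work p = none ↔ k ≤ p
  flag_iff : ∀ p, flag (work p) = true ↔ p = 0

theorem WellFormed.digit_eq_zero {K k : ℕ} {work : ℕ → DigitCell ι} (h : WellFormed K k work)
    {p : ℕ} (hp : k ≤ p) (i : ι) : digit (work p) i = 0 := by
  rw [(h.eq_none_iff p).2 hp]; rfl

theorem two_mul_abs_value_lt (work : ℕ → DigitCell ι) (p : ℕ) (i : ι) :
    2 * |value work p i| < 3 ^ p :=
  two_mul_abs_sum_ternary_lt _ (fun _ => SignType.abs_cast_le_one _) p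

theorem value_congr {work work' : ℕ → DigitCell ι} {p : ℕ} (h : ∀ j < p, work j = work' j) (i : ι) :
    value work p i = value work' p i :=
  Finset.sum_congr rfl fun j hj => by rw [h j (Finset.mem_range.1 hj)]

theorem value_succ (work : ℕ → DigitCell ι) (p : ℕ) (i : ι) :
    value work (p + 1) i = value work p i + 3 ^ p * (digit (work p) i : ℤ) :=
  Finset.sum_range_succ _ _

theorem value_eq_add (work : ℕ → DigitCell ι) {p K : ℕ} (h : p ≤ K) (i : ι) :
    value work K i =
      value work p i + ∑ j ∈ Finset.Ico p K, 3 ^ j * (digit (work j) i : ℤ) :=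
  (Finset.sum_range_add_sum_Ico _ h).symm

end DigitCell

namespace RegisterTransducer

open DigitCell

variable {A B ι : Type}

/-- Started in state `q` with input position `p`, register values `x` and output `out`, the register
transducer halts with output `v`, and all later register values `y` satisfy `2 * |y i| < b`. -/
inductive HaltsFrom (P : RegisterTransducer A B ι) (w : List A) (v : List B) (b : ℤ) :
    P.C → ℕ → (ι → ℤ) → List B → Prop
  | halt (q : P.C) (p : ℕ) (x : ι → ℤ)
      (h : P.δ q (Transducer.inputAt w p) (fun i => SignType.sign (x i)) = none) :
      HaltsFrom P w v b q p x v
  | step (q : P.C) (p : ℕ) (x : ι → ℤ) (out : List B) (a : RegisterAction B P.C ι)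
      (h : P.δ q (Transducer.inputAt w p) (fun i => SignType.sign (x i)) = some a)
      (hb : ∀ i, 2 * |a.update x i| < b)
      (h' : HaltsFrom P w v b a.state (min (a.inputMove.apply p) (w.length + 1)) (a.update x)
        (out ++ a.output)) :
      HaltsFrom P w v b q p x out

theorem HaltsFrom.of_step {P : RegisterTransducer A B ι} {w : List A} {v : List B} {b : ℤ}
    {q q' : P.C} {p p' : ℕ} {x y : ι → ℤ} {out out' : List B} (a : RegisterAction B P.C ι)
    (h : P.δ q (Transducer.inputAt w p) (fun i => SignType.sign (x i)) = some a)
    (hq : a.state = q') (hp : min (a.inputMove.apply p) (w.length + 1) = p')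
    (hy : a.update x = y) (hout : out ++ a.output = out') (hb : ∀ i, 2 * |y i| < b)
    (h' : HaltsFrom P w v b q' p' y out') : HaltsFrom P w v b q p x out := by
  subst hq hp hy hout
  exact .step q p x out a h hb h'

variable [Finite A] [Finite B] [Finite ι]

open Classical in
/-- The Turing machine that simulates a register transducer: its work tape has one track per
register, which holds the value of the register in balanced ternary. Every update is carried out in
one sweep from left to right, in which the machine also finds the signs of the new values. -/
noncomputable def toTransducer (P : RegisterTransducer A B ι) : Transducer A B :=
  haveI := P.finiteC
  { Q := SweepState P.C ι
    Γ := DigitCell ι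
    start := .start
    blank := none
    δ := fun q a γ => match q with
      | .start => some ⟨.ready P.start P.initial, some (true, P.initial), .stay, .stay, []⟩
      | .ready q sgn => (P.δ q a sgn).map fun act =>
          ⟨.sweep act.state act.coeff act.source 0 0, γ, act.inputMove, .stay, act.output⟩
      | .sweep q coeff source carry sgn =>
          if γ = none ∧ carry = 0 then some ⟨.back q sgn, γ, .stay, .left, []⟩
          else
            let t : ι → ℤ := fun i => digit γ i + coeff i * digit γ (source i) + carry i
            some ⟨.sweep q coeff source (fun i => ternaryCarry (t i))
                (fun i => if ternaryDigit (t i) = 0 then sgn i else ternaryDigit (t i)),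
              some (flag γ, fun i => ternaryDigit (t i)), .stay, .right, []⟩
      | .back q sgn =>
          if flag γ = true then some ⟨.ready q sgn, γ, .stay, .stay, []⟩
          else some ⟨.back q sgn, γ, .stay, .left, []⟩ }

variable {P : RegisterTransducer A B ι} {w : List A} {v : List B}

theorem haltsFrom_back {s K k : ℕ} {q : P.C} {sgn : ι → SignType} {n : ℕ}
    {work : ℕ → DigitCell ι} {out : List B} (hn : n ≤ w.length + 1) (hwf : WellFormed K k work)
    (hK : K < s) (h : P.toTransducer.HaltsFrom w v s ⟨.ready q sgn, n, work, 0, out⟩) (p : ℕ)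
    (hp : p < k) : P.toTransducer.HaltsFrom w v s ⟨.back q sgn, n, work, p, out⟩ := by
  have hle := hwf.le
  induction p with
  | zero =>
    refine .step _ _ ?_ (by simp; omega) h
    have h0 : flag (work 0) = true := (hwf.flag_iff 0).2 rfl
    simp [Transducer.step, toTransducer, h0, HeadMove.apply, hn]
  | succ p ih =>
    refine .step _ _ ?_ (by simp; omega) (ih (by omega))
    have h0 : ¬ flag (work (p + 1)) = true := fun h => by
      have := (hwf.flag_iff (p + 1)).1 h
      omega
    simp only [Bool.not_eq_true] at h0
    simp [Transducer.step, toTransducer, h0, HeadMove.apply, hn]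

/-- At the first blank with no carry left, all higher digits are zero, so the prefix already
processed is the full new value. The head then steps back onto the last used square. -/
theorem haltsFrom_sweep_end {s K k : ℕ} {q : P.C} {coeff : ι → SignType} {source : ι → ι} {n : ℕ}
    {out : List B} {y : ι → ℤ} {work : ℕ → DigitCell ι} {carry : ι → SignType}
    (hn : n ≤ w.length + 1) (hwf : WellFormed K k work) (hK : K < s)
    (h : ∀ work' k', WellFormed K k' work' → (∀ i, value work' K i = y i) →
      P.toTransducer.HaltsFrom w v s
        ⟨.back q (fun i => SignType.sign (y i)), n, work', k' - 1, out⟩)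
    (hc : carry = 0) {p : ℕ} (hp : p = k) (hy : ∀ i, y i = value work p i) :
    P.toTransducer.HaltsFrom w v s
      ⟨.sweep q coeff source carry (fun i => SignType.sign (value work p i)), n, work, p, out⟩ := by
  subst hp
  have hle := hwf.le
  have hnone : work p = none := (hwf.eq_none_iff p).2 le_rfl
  refine .step _ _ ?_ (by simp; omega) (h work p hwf fun i => ?_)
  · simp [Transducer.step, toTransducer, hnone, hc, HeadMove.apply, hn, ← hy]
  · rw [value_eq_add work hle, ← hy, Finset.sum_eq_zero, add_zero]
    intro j hj
    simp [hwf.digit_eq_zero (Finset.mem_Ico.1 hj).1]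

/-- Invariant of the sweep: the target `y` is the finished low part, plus the carry with weight `3 ^
p`, plus the update still to be made on the squares from `p` on. The induction is on the number `m`
of squares left. -/
theorem haltsFrom_sweep {s K : ℕ} {q : P.C} {coeff : ι → SignType} {source : ι → ι} {n : ℕ}
    {out : List B} {y : ι → ℤ} (hn : n ≤ w.length + 1) (hK : K < s)
    (hy : ∀ i, 2 * |y i| < 3 ^ K)
    (h : ∀ work' k', WellFormed K k' work' → (∀ i, value work' K i = y i) →
      P.toTransducer.HaltsFrom w v s
        ⟨.back q (fun i => SignType.sign (y i)), n, work', k' - 1, out⟩)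
    (m : ℕ) : ∀ (p k : ℕ) (work : ℕ → DigitCell ι) (carry : ι → SignType), p + m = K → p ≤ k →
      WellFormed K k work →
      (∀ i, y i = value work p i + 3 ^ p * (carry i : ℤ) + ∑ j ∈ Finset.Ico p K,
        3 ^ j * ((digit (work j) i : ℤ) + coeff i * digit (work j) (source i))) →
      P.toTransducer.HaltsFrom w v s
        ⟨.sweep q coeff source carry (fun i => SignType.sign (value work p i)), n, work, p, out⟩ := by
  induction m with
  | zero =>
    intro p k work carry hpK hpk hwf hval
    obtain rfl : p = K := by omega
    obtain rfl : p = k := le_antisymm hpk hwf.le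
    -- Both `y i` and the finished part are below `3 ^ p / 2` in absolute value, so their difference
    -- `3 ^ p * carry i` is less than `3 ^ p`: no overflow occurs.
    have hc : carry = 0 := by
      funext i
      have h1 := two_mul_abs_value_lt work p i
      have h2 := hy i
      have h3 := hval i
      simp only [Finset.Ico_self, Finset.sum_empty, add_zero] at h3
      have h4 : (carry i : ℤ) < 1 ∧ (-1 : ℤ) < carry i := by
        have h5 := neg_abs_le (y i)
        have h6 := le_abs_self (y i)
        have h7 := neg_abs_le (value work p i)
        have h8 := le_abs_self (value work p i)
        have h9 : (0 : ℤ) < 3 ^ p := by positivity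
        constructor <;> nlinarith
      generalize carry i = c at h4
      cases c <;> simp_all
    exact haltsFrom_sweep_end hn hwf hK h hc rfl (fun i => by simp [hval i, hc])
  | succ m ih =>
    intro p k work carry hpK hpk hwf hval
    by_cases hend : work p = none ∧ carry = 0
    · obtain rfl : p = k := le_antisymm hpk ((hwf.eq_none_iff p).1 hend.1)
      refine haltsFrom_sweep_end hn hwf hK h hend.2 rfl fun i => ?_
      rw [hval i, hend.2, Finset.sum_eq_zero]
      · simp
      · intro j hj
        have hj' := (Finset.mem_Ico.1 hj).1
        simp [hwf.digit_eq_zero hj']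
    · set t : ι → ℤ := fun i => digit (work p) i + coeff i * digit (work p) (source i) + carry i
        with ht
      have htdigit : ∀ i, (ternaryDigit (t i) : ℤ) + 3 * ternaryCarry (t i) = t i := by
        intro i
        refine ternaryDigit_add_ternaryCarry ?_
        simp only [ht]
        generalize digit (work p) i = a
        generalize digit (work p) (source i) = b
        generalize coeff i = c
        generalize carry i = d
        revert a b c d
        decide
      set work' : ℕ → DigitCell ι :=
        Function.update work p (some (flag (work p), fun i => ternaryDigit (t i))) with hwork'
      have hne : ∀ j, j ≠ p → work' j = work j := fun j hj => by simp [hwork', hj]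
      have hself : work' p = some (flag (work p), fun i => ternaryDigit (t i)) := by
        simp [hwork']
      have hpre : ∀ i, value work' p i = value work p i :=
        value_congr fun j hj => hne j hj.ne
      have hval' : ∀ i, value work' (p + 1) i =
          value work p i + 3 ^ p * (ternaryDigit (t i) : ℤ) := fun i => by
        rw [value_succ, hpre, hself]; rfl
      -- The used region grows by one square exactly when a remaining carry is written on the first
      -- blank.
      have hwf' : WellFormed K (max k (p + 1)) work' := by
        refine ⟨le_max_of_le_left hwf.pos, max_le hwf.le (by omega), fun j => ?_, fun j => ?_⟩
        · rcases eq_or_ne j p with rfl | hj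
          · simp [hself]
          · rw [hne j hj, hwf.eq_none_iff]
            omega
        · rcases eq_or_ne j p with rfl | hj
          · rw [hself, ← hwf.flag_iff]; rfl
          · rw [hne j hj, hwf.flag_iff]
      have hstep := ih (p + 1) (max k (p + 1)) work' (fun i => ternaryCarry (t i)) (by omega)
        (le_max_right _ _) hwf' fun i => by
          rw [hval' i, hval i, Finset.sum_eq_sum_Ico_succ_bot (by omega)]
          have h1 : ∑ j ∈ Finset.Ico (p + 1) K, (3 : ℤ) ^ j * ((digit (work' j) i : ℤ) +
              coeff i * digit (work' j) (source i)) = ∑ j ∈ Finset.Ico (p + 1) K, (3 : ℤ) ^ j *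
              ((digit (work j) i : ℤ) + coeff i * digit (work j) (source i)) :=
            Finset.sum_congr rfl fun j hj => by
              rw [hne j (by have := (Finset.mem_Ico.1 hj).1; omega)]
          rw [h1]
          have h2 := htdigit i
          simp only [ht] at h2 ⊢
          rw [pow_succ]
          linear_combination (-3 ^ p : ℤ) * h2
      refine .step _ _ ?_ (by simp; omega) hstep
      -- The signs kept in the control are those of the prefix swept so far.
      have hsgn : (fun i => SignType.sign (value work' (p + 1) i)) = fun i =>
          if ternaryDigit (t i) = 0 then SignType.sign (value work p i) else ternaryDigit (t i) := by
        funext i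
        rw [hval' i, sign_add_pow_mul (two_mul_abs_value_lt work p i)]
      rw [hsgn]
      simp [Transducer.step, toTransducer, hend, HeadMove.apply, hn, ht, hwork']

/-- A step of the register transducer is simulated by a sweep over the work tape and back. -/
theorem HaltsFrom.haltsFrom_ready {s K : ℕ} (hK : K < s) {q : P.C} {n : ℕ} {x : ι → ℤ}
    {out : List B} (h : P.HaltsFrom w v (3 ^ K) q n x out) :
    ∀ {k : ℕ} {work : ℕ → DigitCell ι}, n ≤ w.length + 1 → WellFormed K k work →
      (∀ i, value work K i = x i) →
      P.toTransducer.HaltsFrom w v s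
        ⟨.ready q (fun i => SignType.sign (x i)), n, work, 0, out⟩ := by
  induction h with
  | halt q n x h =>
    intro k work hn hwf hval
    refine .halt _ ?_ rfl (by simp; omega)
    simp [Transducer.step, toTransducer, h]
  | step q n x out a h hb _ ih =>
    intro k work hn hwf hval
    have hn' : min (a.inputMove.apply n) (w.length + 1) ≤ w.length + 1 := min_le_right _ _
    -- The sweep starts at square 0 with an empty prefix, whose value and signs are zero, so the
    -- invariant is just the register update expanded in digits.
    have hsweep := haltsFrom_sweep (P := P) (w := w) (v := v) (s := s) (q := a.state)
      (coeff := a.coeff) (source := a.source) (out := out ++ a.output) hn' hK hb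
      (fun work' k' hwf' hval' => haltsFrom_back hn' hwf' hK (ih hn' hwf' hval') _
        (by have := hwf'.pos; omega)) K 0 k work 0 (by omega) (by omega) hwf fun i => by
          simp [RegisterAction.update, ← hval, value, mul_add, Finset.sum_add_distrib,
            Finset.mul_sum, mul_left_comm]
    refine .step _ _ ?_ (by simp; omega) hsweep
    simp [Transducer.step, toTransducer, h, HeadMove.apply, value]
    rfl

/-- A register transducer whose registers stay below `3 ^ K` is simulated in space `K + 1`. -/
theorem HaltsFrom.computesInSpace {s K : ℕ} (hK : K < s) (hK0 : 1 ≤ K)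
    (h : P.HaltsFrom w v (3 ^ K) P.start 0 (fun i => (P.initial i : ℤ)) []) :
    P.toTransducer.ComputesInSpace w v s := by
  refine Transducer.HaltsFrom.computesInSpace ?_
  set work : ℕ → DigitCell ι := Function.update (fun _ => none) 0 (some (true, P.initial))
    with hwork
  have hne : ∀ p, p ≠ 0 → work p = none := fun p hp => by simp [hwork, hp]
  have hwf : WellFormed K 1 work := by
    refine ⟨le_rfl, hK0, fun p => ?_, fun p => ?_⟩
    · rcases eq_or_ne p 0 with rfl | hp
      · simp [hwork]
      · simp [hne p hp]; omega
    · rcases eq_or_ne p 0 with rfl | hp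
      · simp [hwork, flag]
      · simp [hne p hp, hp, flag]
  have hval : ∀ i, value work K i = P.initial i := fun i => by
    rw [value, Finset.sum_eq_single_of_mem 0 (Finset.mem_range.2 hK0)]
    · simp [hwork, digit]
    · intro j _ hj
      simp [hne j hj, digit]
  have := h.haltsFrom_ready hK (by omega) hwf hval
  refine .step _ _ ?_ (by simp [Transducer.init]; omega) this
  have hs : (fun i => SignType.sign (P.initial i : ℤ)) = P.initial := by
    funext i
    generalize P.initial i = a
    cases a <;> rfl
  simp [Transducer.step, Transducer.init, toTransducer, HeadMove.apply, hs, hwork]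

end RegisterTransducer

/-! ### Entries of unitriangular matrices -/

section UnitriangularEntries

variable {r : ℕ}

/-- The entry of a unitriangular matrix at a position above the diagonal. -/
def UT.entry (M : UT r) (p : UpperPos r) : ℤ := M.1.1 p.1.1 p.1.2

theorem UT.apply_eq_zero (M : UT r) {i j : Fin r} (h : j < i) : M.1.1 i j = 0 := M.2.1 h

theorem UT.apply_self (M : UT r) (i : Fin r) : M.1.1 i i = 1 := M.2.2 i

theorem UT.mul_apply (M N : UT r) (i j : Fin r) :
    (M * N).1.1 i j = ∑ k, M.1.1 i k * N.1.1 k j := rfl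

theorem UT.entry_one (p : UpperPos r) : UT.entry 1 p = 0 := Matrix.one_apply_ne p.2.ne

theorem UT.eq_one_of_entry_eq_zero {M : UT r} (h : ∀ p, UT.entry M p = 0) : M = 1 := by
  apply Subtype.ext
  apply Subtype.ext
  ext i j
  rcases lt_trichotomy i j with hij | rfl | hij
  · exact (h ⟨(i, j), hij⟩).trans (UT.entry_one ⟨(i, j), hij⟩).symm
  · exact (UT.apply_self M i).trans (UT.apply_self 1 i).symm
  · exact (UT.apply_eq_zero M hij).trans (UT.apply_eq_zero 1 hij).symm

theorem elemMatrix_val (p : UpperPos r) :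
    (elemMatrix p).1.1 = Matrix.transvection p.1.1 p.1.2 1 := rfl

theorem entry_elemMatrix_self (p : UpperPos r) : UT.entry (elemMatrix p) p = 1 := by
  simp [UT.entry, elemMatrix_val, Matrix.transvection, Matrix.one_apply_ne p.2.ne]

theorem entry_elemMatrix_of_ne {p q : UpperPos r} (h : q ≠ p) :
    UT.entry (elemMatrix p) q = 0 := by
  have h' : ¬(p.1.1 = q.1.1 ∧ p.1.2 = q.1.2) := fun h' =>
    h (Subtype.ext (Prod.ext h'.1.symm h'.2.symm))
  simp [UT.entry, elemMatrix_val, Matrix.transvection, Matrix.one_apply_ne q.2.ne,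
    h']

/-! ### The order of the positions -/

/-- The superdiagonal on which a position lies. -/
def UpperPos.diag (p : UpperPos r) : ℕ := p.1.2.1 - p.1.1.1

/-- `p` is on an earlier superdiagonal than `q`, or further up on the same one. -/
def UpperPos.Before (p q : UpperPos r) : Prop :=
  p.diag < q.diag ∨ p.diag = q.diag ∧ p.1.1 < q.1.1

theorem UpperPos.Before.asymm {p q : UpperPos r} (h : p.Before q) : ¬ q.Before p := by
  rintro (h' | ⟨h', h''⟩) <;> rcases h with h | ⟨h, h'''⟩
  · omega
  · omega
  · omega
  · exact lt_asymm h'' h'''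

theorem mem_pcPositions (p : UpperPos r) : p ∈ pcPositions r := by
  have h : p.1.1.1 < p.1.2.1 := p.2
  have h2 := p.1.2.2
  have heq : p.1.1.1 + (p.1.2.1 - p.1.1.1) = p.1.2.1 := by omega
  refine List.mem_flatMap.2 ⟨p.diag, List.mem_range.2 (by simp only [UpperPos.diag]; omega),
    List.mem_filterMap.2 ⟨p.1.1, List.mem_finRange _, ?_⟩⟩
  rw [dif_pos (by simp only [UpperPos.diag]; omega)]
  simp [UpperPos.diag, heq]

theorem pairwise_pcPositions (r : ℕ) : (pcPositions r).Pairwise UpperPos.Before := by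
  have key : ∀ (d : ℕ) (i : Fin r) (p : UpperPos r),
      (if h : 0 < d ∧ i.1 + d < r then
        some (⟨(i, ⟨i.1 + d, h.2⟩), Fin.lt_def.mpr (Nat.lt_add_of_pos_right h.1)⟩ : UpperPos r)
      else none) = some p → p.diag = d ∧ p.1.1 = i := by
    intro d i p hp
    split_ifs at hp
    obtain rfl := Option.some.inj hp
    simp [UpperPos.diag]
  refine List.pairwise_flatMap.2 ⟨fun d _ => ?_, ?_⟩
  · refine List.pairwise_filterMap.2 ((List.pairwise_lt_finRange r).imp ?_)
    intro i j hij p hp q hq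
    obtain ⟨h1, h2⟩ := key d i p hp
    obtain ⟨h3, h4⟩ := key d j q hq
    exact Or.inr ⟨h1.trans h3.symm, by rwa [h2, h4]⟩
  · refine List.pairwise_lt_range.imp ?_
    intro d d' hd p hp q hq
    obtain ⟨i, -, hi⟩ := List.mem_filterMap.1 hp
    obtain ⟨j, -, hj⟩ := List.mem_filterMap.1 hq
    exact Or.inl (by rw [(key d i p hi).1, (key d' j q hj).1]; exact hd)

theorem mem_of_before {l₁ l₂ : List (UpperPos r)} {p q : UpperPos r}
    (h : pcPositions r = l₁ ++ p :: l₂) (hq : q.Before p) : q ∈ l₁ := by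
  have hmem := mem_pcPositions q
  have hpw := pairwise_pcPositions r
  rw [h] at hmem hpw
  rcases List.mem_append.1 hmem with hm | hm
  · exact hm
  · rcases List.mem_cons.1 hm with rfl | hm
    · exact absurd hq hq.asymm
    · exact absurd hq
        ((List.pairwise_cons.1 (List.pairwise_append.1 hpw).2.1).1 q hm).asymm

theorem ne_of_mem_append {l₁ l₂ : List (UpperPos r)} (h : pcPositions r = l₁ ++ l₂)
    {p q : UpperPos r} (hq : q ∈ l₁) (hp : p ∈ l₂) : q ≠ p := by
  rintro rfl
  have hpw := pairwise_pcPositions r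
  rw [h] at hpw
  have := (List.pairwise_append.1 hpw).2.2 q hq q hp
  exact this.asymm this

/-! ### Matrices that vanish on the first positions -/

/-- If `M` vanishes at all positions before `p`, then the entries at `p` add up in `M * N`. -/
theorem entry_mul {l₁ l₂ : List (UpperPos r)} {p : UpperPos r} (h : pcPositions r = l₁ ++ p :: l₂)
    {M : UT r} (hM : ∀ q ∈ l₁, UT.entry M q = 0) (N : UT r) :
    UT.entry (M * N) p = UT.entry M p + UT.entry N p := by
  rw [UT.entry, UT.mul_apply, Finset.sum_eq_add_of_mem p.1.2 p.1.1 (Finset.mem_univ _)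
    (Finset.mem_univ _) p.2.ne']
  · rw [UT.apply_self, UT.apply_self, mul_one, one_mul]; rfl
  · rintro k - ⟨hk1, hk2⟩
    rcases lt_or_gt_of_ne hk2 with h1 | h1
    · rw [UT.apply_eq_zero M h1, zero_mul]
    · rcases lt_or_gt_of_ne hk1 with h2 | h2
      -- For `k` strictly between the two indices, `(p.1.1, k)` is on an earlier superdiagonal than
      -- `p`, so `M` vanishes there. Nothing is needed of `N`.
      · have : UT.entry M ⟨(p.1.1, k), h1⟩ = 0 := by
          refine hM _ (mem_of_before h (Or.inl ?_))
          simp only [UpperPos.diag]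
          have h3 : k.1 < p.1.2.1 := h2
          have h4 : p.1.1.1 < k.1 := h1
          omega
        rw [UT.entry] at this
        simp only at this
        rw [this, zero_mul]
      · rw [UT.apply_eq_zero N h2, mul_zero]

/-- The unitriangular matrices that vanish on the first positions, those in `l₁`. -/
def vanishingSubgroup {l₁ l₂ : List (UpperPos r)} (h : pcPositions r = l₁ ++ l₂) :
    Subgroup (UT r) where
  carrier := {M | ∀ q ∈ l₁, UT.entry M q = 0}
  one_mem' := fun q _ => UT.entry_one q
  mul_mem' := by
    intro M N hM hN q hq
    obtain ⟨s, t, hst⟩ := List.append_of_mem hq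
    have h' : pcPositions r = s ++ q :: (t ++ l₂) := by rw [h, hst]; simp
    rw [entry_mul h' (fun q' hq' => hM q' (by rw [hst]; simp [hq'])), hM q hq, hN q hq, add_zero]
  inv_mem' := by
    intro M hM q hq
    obtain ⟨s, t, hst⟩ := List.append_of_mem hq
    have h' : pcPositions r = s ++ q :: (t ++ l₂) := by rw [h, hst]; simp
    have := entry_mul h' (fun q' hq' => hM q' (by rw [hst]; simp [hq'])) M⁻¹
    rw [mul_inv_cancel, UT.entry_one, hM q hq, zero_add] at this
    exact this.symm

theorem mem_vanishingSubgroup {l₁ l₂ : List (UpperPos r)} (h : pcPositions r = l₁ ++ l₂)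
    {M : UT r} : M ∈ vanishingSubgroup h ↔ ∀ q ∈ l₁, UT.entry M q = 0 := Iff.rfl

theorem elemMatrix_mem_vanishingSubgroup {l₁ l₂ : List (UpperPos r)}
    (h : pcPositions r = l₁ ++ l₂) {p : UpperPos r} (hp : p ∈ l₂) :
    elemMatrix p ∈ vanishingSubgroup h :=
  fun _ hq => entry_elemMatrix_of_ne (ne_of_mem_append h hq hp)

/-- The entry at the first position where the matrices need not vanish is a homomorphism. -/
def vanishingSubgroup.entryHom {l₁ l₂ : List (UpperPos r)} {p : UpperPos r}
    (h : pcPositions r = l₁ ++ p :: l₂) : vanishingSubgroup h →* Multiplicative ℤ where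
  toFun M := Multiplicative.ofAdd (UT.entry M.1 p)
  map_one' := congrArg Multiplicative.ofAdd (UT.entry_one p)
  map_mul' M N := congrArg Multiplicative.ofAdd (entry_mul h M.2 N.1)

theorem entry_elemMatrix_zpow {l₁ l₂ : List (UpperPos r)} {p : UpperPos r}
    (h : pcPositions r = l₁ ++ p :: l₂) (e : ℤ) : UT.entry (elemMatrix p ^ e) p = e := by
  have := map_zpow (vanishingSubgroup.entryHom h)
    ⟨elemMatrix p, elemMatrix_mem_vanishingSubgroup h (by simp)⟩ e
  have h2 := congrArg Multiplicative.toAdd this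
  simpa [vanishingSubgroup.entryHom, entry_elemMatrix_self] using h2

theorem vanishing_append_singleton {l₁ l₂ : List (UpperPos r)} {p : UpperPos r}
    (h : pcPositions r = l₁ ++ p :: l₂) (h' : pcPositions r = (l₁ ++ [p]) ++ l₂) {M : UT r} :
    M ∈ vanishingSubgroup h' ↔ M ∈ vanishingSubgroup h ∧ UT.entry M p = 0 := by
  simp only [mem_vanishingSubgroup, List.mem_append, List.mem_singleton, or_imp, forall_and,
    forall_eq]

/-- Both factors vanish before `p`, so their entries at `p` add up to zero and the earlier zeros
survive. -/
theorem zpow_mul_mem_vanishing {l₁ l₂ : List (UpperPos r)} {p : UpperPos r}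
    (h : pcPositions r = l₁ ++ p :: l₂) (h' : pcPositions r = (l₁ ++ [p]) ++ l₂) {M : UT r}
    (hM : M ∈ vanishingSubgroup h) :
    elemMatrix p ^ (-UT.entry M p) * M ∈ vanishingSubgroup h' := by
  have hE : elemMatrix p ^ (-UT.entry M p) ∈ vanishingSubgroup h :=
    Subgroup.zpow_mem _ (elemMatrix_mem_vanishingSubgroup h (by simp)) _
  refine (vanishing_append_singleton h h').2 ⟨mul_mem hE hM, ?_⟩
  rw [entry_mul h hE, entry_elemMatrix_zpow h, neg_add_cancel]

/-! ### The normal form -/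

theorem wordEval_append {X G : Type} [Group G] (val : X → G) (u v : List X) :
    wordEval val (u ++ v) = wordEval val u * wordEval val v := by
  simp [wordEval]

theorem wordEval_powerWord (p : UpperPos r) (e : ℤ) :
    wordEval letterVal (powerWord p e) = elemMatrix p ^ e := by
  rw [wordEval, powerWord, List.map_replicate, List.prod_replicate, letterVal]
  rcases le_or_gt 0 e with he | he
  · lift e to ℕ using he
    simp
  · obtain ⟨n, rfl⟩ : ∃ n : ℕ, e = -n := ⟨e.natAbs, by omega⟩
    have hn : n ≠ 0 := by omega
    simp [hn]

/-- The word read off from a matrix by clearing the positions in the given list one after the other,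
by multiplication with elementary matrices from the left. -/
def clearingWord : List (UpperPos r) → UT r → List (UTLetter r)
  | [], _ => []
  | p :: l, M =>
    powerWord p (UT.entry M p) ++ clearingWord l (elemMatrix p ^ (-UT.entry M p) * M)

/-- Each clearing moves the matrix one step down the chain of subgroups, until only the identity is
left; the recorded powers undo the clearings. -/
theorem wordEval_clearingWord (l₂ : List (UpperPos r)) :
    ∀ (l₁ : List (UpperPos r)) (h : pcPositions r = l₁ ++ l₂) (M : UT r),
      M ∈ vanishingSubgroup h → wordEval letterVal (clearingWord l₂ M) = M := by
  induction l₂ with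
  | nil =>
    intro l₁ h M hM
    refine (UT.eq_one_of_entry_eq_zero fun p => hM p ?_).symm
    have := mem_pcPositions p
    rwa [h, List.append_nil] at this
  | cons p l ih =>
    intro l₁ h M hM
    have h' : pcPositions r = (l₁ ++ [p]) ++ l := by rw [h]; simp
    rw [clearingWord, wordEval_append, wordEval_powerWord,
      ih _ h' _ (zpow_mul_mem_vanishing h h' hM), ← mul_assoc, ← zpow_add, add_neg_cancel,
      zpow_zero, one_mul]

theorem wordEval_flatMap_mem {l₁ l₂ : List (UpperPos r)} (h : pcPositions r = l₁ ++ l₂)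
    (e : UpperPos r → ℤ) {l : List (UpperPos r)} (hl : l ⊆ l₂) :
    wordEval letterVal (l.flatMap fun p => powerWord p (e p)) ∈ vanishingSubgroup h := by
  induction l with
  | nil => exact one_mem _
  | cons p l ih =>
    rw [List.flatMap_cons, wordEval_append, wordEval_powerWord]
    exact mul_mem (Subgroup.zpow_mem _ (elemMatrix_mem_vanishingSubgroup h (hl (by simp))) _)
      (ih fun q hq => hl (by simp [hq]))

/-- Uniqueness of the exponents: the tail of the word vanishes at `p`, so the entry at `p` of the
whole product is `e p`, and clearing strips off exactly the first power. -/
theorem clearingWord_wordEval (e : UpperPos r → ℤ) (l₂ : List (UpperPos r)) :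
    ∀ l₁ : List (UpperPos r), pcPositions r = l₁ ++ l₂ →
      clearingWord l₂ (wordEval letterVal (l₂.flatMap fun p => powerWord p (e p))) =
        l₂.flatMap fun p => powerWord p (e p) := by
  induction l₂ with
  | nil => intro _ _; rfl
  | cons p l ih =>
    intro l₁ h
    have h' : pcPositions r = (l₁ ++ [p]) ++ l := by rw [h]; simp
    have hmem := wordEval_flatMap_mem h' e (List.Subset.refl l)
    have hE : elemMatrix p ^ e p ∈ vanishingSubgroup h :=
      Subgroup.zpow_mem _ (elemMatrix_mem_vanishingSubgroup h (by simp)) _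
    rw [List.flatMap_cons, wordEval_append, wordEval_powerWord, clearingWord, entry_mul h hE,
      entry_elemMatrix_zpow h, ((vanishing_append_singleton h h').1 hmem).2, add_zero, ← mul_assoc,
      ← zpow_add, neg_add_cancel, zpow_zero, one_mul, ih _ h']

theorem exists_clearingWord_eq (l : List (UpperPos r)) (hl : l.Nodup) (M : UT r) :
    ∃ e : UpperPos r → ℤ, clearingWord l M = l.flatMap fun p => powerWord p (e p) := by
  induction l generalizing M with
  | nil => exact ⟨0, rfl⟩
  | cons p l ih =>
    obtain ⟨hp, hl⟩ := List.nodup_cons.1 hl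
    obtain ⟨e, he⟩ := ih hl (elemMatrix p ^ (-UT.entry M p) * M)
    refine ⟨Function.update e p (UT.entry M p), ?_⟩
    rw [clearingWord, he, List.flatMap_cons, Function.update_self]
    congr 1
    refine List.flatMap_congr fun q hq => ?_
    rw [Function.update_of_ne (ne_of_mem_of_not_mem hq hp)]

theorem nodup_pcPositions (r : ℕ) : (pcPositions r).Nodup :=
  (pairwise_pcPositions r).imp fun h h' => by subst h'; exact h.asymm h

theorem clearingWord_mem_pcNormalForm (M : UT r) :
    clearingWord (pcPositions r) M ∈ pcNormalForm r := by
  obtain ⟨e, he⟩ := exists_clearingWord_eq (pcPositions r) (nodup_pcPositions r) M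
  exact ⟨e, he.symm⟩

theorem wordEval_clearingWord_pcPositions (M : UT r) :
    wordEval letterVal (clearingWord (pcPositions r) M) = M :=
  wordEval_clearingWord _ [] rfl M fun q hq => absurd hq (by simp)

theorem isNormalForm_pcNormalForm (r : ℕ) :
    IsNormalForm (letterVal (r := r)) (pcNormalForm r) := by
  refine ⟨fun _ _ => Set.mem_univ _, ?_, fun M _ =>
    ⟨_, clearingWord_mem_pcNormalForm M, wordEval_clearingWord_pcPositions M⟩⟩
  have key : ∀ u ∈ pcNormalForm r, clearingWord (pcPositions r) (wordEval letterVal u) = u := by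
    rintro _ ⟨e, rfl⟩
    exact clearingWord_wordEval e _ [] rfl
  exact fun u hu v hv huv => (key u hu).symm.trans (huv ▸ key v hv)

/-! ### The polycyclic generating sequence -/

/-- A matrix that vanishes on `l₁` is spelled by its clearing word, which uses only elementary
matrices from `l₂`. -/
theorem closure_elemMatrix_eq {l₁ l₂ : List (UpperPos r)} (h : pcPositions r = l₁ ++ l₂) :
    Subgroup.closure {g | g ∈ l₂.map elemMatrix} = vanishingSubgroup h := by
  apply le_antisymm
  · rw [Subgroup.closure_le]
    intro g hg
    obtain ⟨p, hp, rfl⟩ := List.mem_map.1 hg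
    exact elemMatrix_mem_vanishingSubgroup h hp
  · intro M hM
    rw [← wordEval_clearingWord l₂ l₁ h M hM]
    have hword : ∀ (l : List (UpperPos r)) (M : UT r), l ⊆ l₂ →
        wordEval letterVal (clearingWord l M) ∈
          Subgroup.closure {g | g ∈ l₂.map elemMatrix} := by
      intro l
      induction l with
      | nil => intro M _; exact one_mem _
      | cons p l ih =>
        intro M hl
        rw [clearingWord, wordEval_append, wordEval_powerWord]
        have hp : elemMatrix p ∈ {g | g ∈ l₂.map elemMatrix} :=
          List.mem_map.2 ⟨p, hl (by simp), rfl⟩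
        exact mul_mem (Subgroup.zpow_mem _ (Subgroup.subset_closure hp) _)
          (ih _ fun q hq => hl (by simp [hq]))
    exact hword l₂ M (List.Subset.refl _)

theorem isPolycyclicGeneratingSequence_elemMatrix (r : ℕ) :
    IsPolycyclicGeneratingSequence ((pcPositions r).map elemMatrix) := by
  refine ⟨?_, fun k hk => ?_⟩
  · rw [closure_elemMatrix_eq (l₁ := []) (l₂ := pcPositions r) rfl, eq_top_iff]
    exact fun M _ q hq => absurd hq (by simp)
  · rw [List.length_map] at hk
    have h : pcPositions r = (pcPositions r).take k ++ (pcPositions r)[k] ::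
        (pcPositions r).drop (k + 1) := by
      rw [← List.drop_eq_getElem_cons hk, List.take_append_drop]
    have h' : pcPositions r = ((pcPositions r).take k ++ [(pcPositions r)[k]]) ++
        (pcPositions r).drop (k + 1) := by
      rw [List.append_assoc, List.singleton_append]; exact h
    rw [← List.map_drop, ← List.map_drop, List.drop_eq_getElem_cons hk, closure_elemMatrix_eq h,
      closure_elemMatrix_eq h']
    refine ⟨fun n hn g => ?_⟩
    rw [Subgroup.mem_subgroupOf] at hn ⊢
    obtain ⟨hn1, hn2⟩ := (vanishing_append_singleton h h').1 hn
    refine (vanishing_append_singleton h h').2 ⟨(g * n * g⁻¹).2, ?_⟩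
    -- The entry at the `k`-th position is additive on the larger subgroup, so the contributions of
    -- `g` and `g⁻¹` cancel in the conjugate.
    have h1 := entry_mul h g.2 g.1⁻¹
    rw [mul_inv_cancel, UT.entry_one] at h1
    change UT.entry (g.1 * n.1 * g.1⁻¹) _ = 0
    rw [entry_mul h (mul_mem g.2 hn1), entry_mul h g.2, hn2, add_zero, ← h1]

end UnitriangularEntries

/-! ### Letters act by adding columns or rows -/

section Machine

variable {r : ℕ}

/-- The sign of the exponent of a letter. -/
def letterSign (b : Bool) : SignType := if b then 1 else -1

theorem letterVal_val (p : UpperPos r) (b : Bool) :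
    (letterVal (p, b)).1.1 = Matrix.transvection p.1.1 p.1.2 (letterSign b : ℤ) := by
  cases b
  · exact congrArg Subtype.val (Matrix.SpecialLinearGroup.transvection_inv p.2.ne (1 : ℤ))
  · rfl

/-- The column operation is written in the shape of `RegisterAction.update`, so that reading a
letter is a single register action; the row version serves the clearing phase. -/
theorem mul_letterVal_apply (M : UT r) (p : UpperPos r) (b : Bool) (i j : Fin r) :
    (M * letterVal (p, b)).1.1 i j =
      M.1.1 i j + ((if j = p.1.2 then letterSign b else 0 : SignType) : ℤ) * M.1.1 i p.1.1 := by
  change (M.1.1 * (letterVal (p, b)).1.1) i j = _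
  rw [letterVal_val]
  split_ifs with h
  · subst h; simp
  · simp [h]

theorem letterVal_mul_apply (M : UT r) (p : UpperPos r) (b : Bool) (i j : Fin r) :
    (letterVal (p, b) * M).1.1 i j =
      M.1.1 i j + ((if i = p.1.1 then letterSign b else 0 : SignType) : ℤ) * M.1.1 p.1.2 j := by
  change ((letterVal (p, b)).1.1 * M.1.1) i j = _
  rw [letterVal_val]
  split_ifs with h
  · subst h; simp
  · simp [h]

/-- The entries of a product of `n` letters are polynomially bounded in `n`. -/
theorem abs_wordEval_apply_le (u : List (UTLetter r)) (i j : Fin r) :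
    |(wordEval letterVal u).1.1 i j| ≤ ((u.length : ℤ) + 1) ^ (j.1 - i.1) := by
  induction u using List.reverseRecOn generalizing i j with
  | nil =>
    change |(1 : Matrix (Fin r) (Fin r) ℤ) i j| ≤ _
    rw [Matrix.one_apply]
    split_ifs <;> simp
  | append_singleton u x ih =>
    obtain ⟨p, b⟩ := x
    have hmul : wordEval letterVal (u ++ [(p, b)]) = wordEval letterVal u * letterVal (p, b) := by
      simp [wordEval]
    have hmono : ((u.length : ℤ) + 1) ^ (j.1 - i.1) ≤ ((u.length : ℤ) + 1 + 1) ^ (j.1 - i.1) :=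
      pow_le_pow_left₀ (by positivity) (by linarith) _
    rw [hmul, mul_letterVal_apply, List.length_append, List.length_singleton, Nat.cast_add,
      Nat.cast_one]
    split_ifs with h
    · subst h
      rcases lt_or_ge p.1.1 i with hi | hi
      · rw [UT.apply_eq_zero _ hi, mul_zero, add_zero]
        exact (ih _ _).trans hmono
      · have hp : p.1.1.1 < p.1.2.1 := p.2
        have hi' : i.1 ≤ p.1.1.1 := hi
        -- The added column lies further left, so its bound has exponent at most `e`, and `(n + 1) ^
        -- (e + 1) + (n + 1) ^ e = (n + 1) ^ e * (n + 2) ≤ (n + 2) ^ (e + 1)`.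
        obtain ⟨e, he⟩ : ∃ e, p.1.2.1 - i.1 = e + 1 := ⟨p.1.2.1 - i.1 - 1, by omega⟩
        have h1 := ih i p.1.2
        have h2 := (ih i p.1.1).trans
          (pow_le_pow_right₀ (by omega) (by omega : p.1.1.1 - i.1 ≤ e))
        have h3 : |((letterSign b : SignType) : ℤ) * (wordEval letterVal u).1.1 i p.1.1| ≤
            |(wordEval letterVal u).1.1 i p.1.1| := by
          rw [abs_mul]
          exact mul_le_of_le_one_left (abs_nonneg _) (SignType.abs_cast_le_one _)
        have h4 : ((u.length : ℤ) + 1) ^ e ≤ ((u.length : ℤ) + 1 + 1) ^ e :=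
          pow_le_pow_left₀ (by positivity) (by linarith) _
        rw [he] at h1 ⊢
        refine (abs_add_le _ _).trans ?_
        rw [pow_succ] at h1 ⊢
        have h5 : (0 : ℤ) ≤ u.length := by positivity
        nlinarith
    · simp only [SignType.coe_zero, zero_mul, add_zero]
      exact (ih _ _).trans hmono

/-- `M` is a product of at most `N` letters. -/
def IsShortProduct (N : ℕ) (M : UT r) : Prop :=
  ∃ u : List (UTLetter r), u.length ≤ N ∧ wordEval letterVal u = M

theorem IsShortProduct.letterVal_mul {N : ℕ} {M : UT r} (h : IsShortProduct N M)
    (x : UTLetter r) : IsShortProduct (N + 1) (letterVal x * M) := by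
  obtain ⟨u, hu, rfl⟩ := h
  exact ⟨x :: u, by simpa using hu, by simp [wordEval]⟩

theorem IsShortProduct.abs_apply_le {N : ℕ} {M : UT r} (h : IsShortProduct N M) (i j : Fin r) :
    |M.1.1 i j| ≤ (((N + 1) ^ r : ℕ) : ℤ) := by
  obtain ⟨u, hu, rfl⟩ := h
  refine (abs_wordEval_apply_le u i j).trans ?_
  have h1 : (u.length + 1) ^ (j.1 - i.1) ≤ (N + 1) ^ r :=
    (Nat.pow_le_pow_left (by omega) _).trans (Nat.pow_le_pow_right (by omega) (by omega))
  exact_mod_cast h1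

/-- A bound for the entries of all the matrices that occur when `s` positions are cleared in a
product of `N` letters of size `r`. -/
def clearingBound (r : ℕ) : ℕ → ℕ → ℕ
  | 0, N => (N + 1) ^ r
  | s + 1, N => clearingBound r s (N + (N + 1) ^ r)

theorem clearingBound_mono (s : ℕ) {N N' : ℕ} (h : N ≤ N') :
    clearingBound r s N ≤ clearingBound r s N' := by
  induction s generalizing N N' with
  | zero => exact Nat.pow_le_pow_left (by omega) _
  | succ s ih => exact ih (add_le_add h (Nat.pow_le_pow_left (by omega) _))

theorem pow_le_clearingBound (s N : ℕ) : (N + 1) ^ r ≤ clearingBound r s N := by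
  induction s generalizing N with
  | zero => exact le_rfl
  | succ s ih => exact (Nat.pow_le_pow_left (by omega) _).trans (ih _)

/-- Clearing one position replaces `N` by at most `N + (N + 1) ^ r`; iterating this a fixed number
of times stays polynomial. -/
theorem exists_clearingBound_le_pow (r s a : ℕ) :
    ∃ A, ∀ X N : ℕ, 2 ≤ X → N + 1 ≤ X ^ a → clearingBound r s N ≤ X ^ A := by
  induction s generalizing a with
  | zero =>
    exact ⟨a * r, fun X N _ hN => by rw [pow_mul]; exact Nat.pow_le_pow_left hN r⟩
  | succ s ih =>
    -- The new length plus one is at most `X ^ a + X ^ (a * r) ≤ 2 * X ^ (a + a * r)`, and the last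
    -- factor `X ≥ 2` absorbs the 2.
    obtain ⟨A, hA⟩ := ih (a + a * r + 1)
    refine ⟨A, fun X N hX hN => hA X _ hX ?_⟩
    have h1 : (N + 1) ^ r ≤ X ^ (a * r) := by rw [pow_mul]; exact Nat.pow_le_pow_left hN r
    have h2 : X ^ a ≤ X ^ (a + a * r) := Nat.pow_le_pow_right (by omega) (by omega)
    have h3 : X ^ (a * r) ≤ X ^ (a + a * r) := Nat.pow_le_pow_right (by omega) (by omega)
    have h4 : X ^ (a + a * r) * 2 ≤ X ^ (a + a * r) * X := Nat.mul_le_mul_left _ hX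
    rw [pow_succ]
    omega

/-! ### A register transducer for the normal form -/

/-- The suffixes of the list of positions, which record the positions that are still to be
cleared. -/
abbrev PendingPositions (r : ℕ) : Type := {l : List (UpperPos r) // l <:+ pcPositions r}

instance (r : ℕ) : Finite (PendingPositions r) :=
  Finite.of_injective (β := {l // l ∈ (pcPositions r).tails})
    (fun l => ⟨l.1, (List.mem_tails _ _).2 l.2⟩)
    fun _ _ h => Subtype.ext (by simpa using h)

/-- The register transducer that computes normal forms in `UT r`: it multiplies the letters of the
input, and then clears the positions of the product one after the other by multiplication with
letters from the left, writing down their inverses. -/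
def clearingTransducer (r : ℕ) :
    RegisterTransducer (UTLetter r) (UTLetter r) (Fin r × Fin r) where
  C := Option (PendingPositions r)
  start := none
  initial := fun i => if i.1 = i.2 then 1 else 0
  δ
    | none, .leftEnd, _ => some ⟨none, 0, id, .right, []⟩
    | none, .letter (p, b), _ => some ⟨none, fun i => if i.2 = p.1.2 then letterSign b else 0,
        fun i => (i.1, p.1.1), .right, []⟩
    | none, .rightEnd, _ => some ⟨some ⟨pcPositions r, List.suffix_refl _⟩, 0, id, .stay, []⟩
    | some ⟨[], _⟩, _, _ => none
    | some ⟨p :: l, h⟩, _, sgn =>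
      if sgn p.1 = 0 then some ⟨some ⟨l, (List.suffix_cons p l).trans h⟩, 0, id, .stay, []⟩
      else some ⟨some ⟨p :: l, h⟩,
        fun i => if i.1 = p.1.1 then letterSign (!decide (sgn p.1 = 1)) else 0,
        fun i => (p.1.2, i.2), .stay, [(p, decide (sgn p.1 = 1))]⟩

/-- The entries of a unitriangular matrix as register values. -/
def UT.registers (M : UT r) : Fin r × Fin r → ℤ := fun i => M.1.1 i.1 i.2

theorem clearingWord_cons_of_entry_eq_zero {M : UT r} {p : UpperPos r} (h : UT.entry M p = 0)
    (l : List (UpperPos r)) : clearingWord (p :: l) M = clearingWord l M := by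
  simp [clearingWord, h, powerWord]

/-- One pass of the machine's loop: the letter written has the sign of the entry, and multiplying by
its inverse brings the entry one unit closer to zero. -/
theorem clearingWord_cons_of_entry_ne_zero {M : UT r} {p : UpperPos r} (h : UT.entry M p ≠ 0)
    (l : List (UpperPos r)) :
    (UT.entry (letterVal (p, !decide (0 < UT.entry M p)) * M) p).natAbs + 1 =
        (UT.entry M p).natAbs ∧
      clearingWord (p :: l) M = (p, decide (0 < UT.entry M p)) ::
        clearingWord (p :: l) (letterVal (p, !decide (0 < UT.entry M p)) * M) := by
  have hentry : ∀ b, UT.entry (letterVal (p, b) * M) p = UT.entry M p + (letterSign b : ℤ) := by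
    intro b
    rw [UT.entry, letterVal_mul_apply, UT.apply_self, if_pos rfl, mul_one]; rfl
  rcases lt_or_gt_of_ne h with h | h
  · have h1 : UT.entry (letterVal (p, true) * M) p = UT.entry M p + 1 := hentry true
    have h2 : ¬ 0 < UT.entry M p := by omega
    have h3 : (letterVal (p, true) : UT r) = elemMatrix p := rfl
    have h4 : powerWord p (UT.entry M p) = (p, false) :: powerWord p (UT.entry M p + 1) := by
      have h5 : (UT.entry M p).natAbs = (UT.entry M p + 1).natAbs + 1 := by omega
      rw [powerWord, h5, List.replicate_succ, powerWord]
      -- When the exponent rises from `-1` to `0`, the Boolean in `powerWord` flips, but then no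
      -- copies of the letter remain.
      rcases (by omega : UT.entry M p + 1 = 0 ∨ ¬ 0 ≤ UT.entry M p + 1) with h6 | h6
      · simp [h6]; omega
      · simp [h6, show ¬ 0 ≤ UT.entry M p by omega]
    simp only [h2, decide_false, Bool.not_false]
    refine ⟨by omega, ?_⟩
    rw [clearingWord, clearingWord, h1, h4, h3, ← mul_assoc, ← zpow_add_one]
    simp
  · have h1 : UT.entry (letterVal (p, false) * M) p = UT.entry M p - 1 := hentry false
    have h3 : (letterVal (p, false) : UT r) = (elemMatrix p)⁻¹ := rfl
    have h4 : powerWord p (UT.entry M p) = (p, true) :: powerWord p (UT.entry M p - 1) := by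
      have h5 : (UT.entry M p).natAbs = (UT.entry M p - 1).natAbs + 1 := by omega
      rw [powerWord, h5, List.replicate_succ, powerWord]
      rw [decide_eq_true (by omega : 0 ≤ UT.entry M p),
        decide_eq_true (by omega : 0 ≤ UT.entry M p - 1)]
    simp only [h, decide_true, Bool.not_true]
    refine ⟨by omega, ?_⟩
    rw [clearingWord, clearingWord, h1, h4, h3, ← mul_assoc, ← zpow_sub_one]
    simp

open RegisterTransducer in
theorem haltsFrom_clearing (w : List (UTLetter r)) (b : ℤ) (n : ℕ) (hn : n ≤ w.length + 1)
    (l : List (UpperPos r)) (h : l <:+ pcPositions r) :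
    ∀ (N : ℕ) (M : UT r) (out : List (UTLetter r)), IsShortProduct N M →
      2 * (clearingBound r l.length N : ℤ) < b →
      HaltsFrom (clearingTransducer r) w (out ++ clearingWord l M) b (some ⟨l, h⟩) n
        (UT.registers M) out := by
  induction l with
  | nil =>
    intro N M out _ _
    rw [clearingWord, List.append_nil]
    exact .halt _ _ _ rfl
  | cons p l ih =>
    -- Inner induction on the size `t` of the entry at `p`: each pass lengthens the product by one
    -- letter and lowers `t` by one, so `N + t` and the bound built on it do not change.
    have key : ∀ (t N : ℕ) (M : UT r) (out : List (UTLetter r)), (UT.entry M p).natAbs = t →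
        IsShortProduct N M → 2 * (clearingBound r l.length (N + t) : ℤ) < b →
        HaltsFrom (clearingTransducer r) w (out ++ clearingWord (p :: l) M) b (some ⟨p :: l, h⟩) n
          (UT.registers M) out := by
      intro t
      induction t with
      | zero =>
        intro N M out ht hM hb
        have h0 : UT.entry M p = 0 := by omega
        have hs : SignType.sign (UT.registers M p.1) = 0 := by
          change SignType.sign (UT.entry M p) = 0
          rw [h0, sign_zero]
        rw [clearingWord_cons_of_entry_eq_zero h0]
        set a : RegisterAction (UTLetter r) (Option (PendingPositions r)) (Fin r × Fin r) :=
          ⟨some ⟨l, (List.suffix_cons p l).trans h⟩, 0, id, .stay, []⟩ with ha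
        have hupd : a.update (UT.registers M) = UT.registers M := by
          funext i
          simp [RegisterAction.update, ha]
        refine .of_step a ?_ rfl (min_eq_left hn) hupd (List.append_nil _) (fun i => ?_)
          (ih ((List.suffix_cons p l).trans h) N M out hM hb)
        · simp [clearingTransducer, hs, ha]
        · have h1 := hM.abs_apply_le i.1 i.2
          have h2 : (((N + 1) ^ r : ℕ) : ℤ) ≤ clearingBound r l.length (N + 0) := by
            exact_mod_cast pow_le_clearingBound l.length N
          change 2 * |M.1.1 i.1 i.2| < b
          linarith
      | succ t iht =>
        intro N M out ht hM hb
        have h0 : UT.entry M p ≠ 0 := by omega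
        have hs : SignType.sign (UT.registers M p.1) = SignType.sign (UT.entry M p) := rfl
        obtain ⟨h1, h2⟩ := clearingWord_cons_of_entry_ne_zero h0 l
        set c := decide (0 < UT.entry M p) with hc
        set a : RegisterAction (UTLetter r) (Option (PendingPositions r)) (Fin r × Fin r) :=
          ⟨some ⟨p :: l, h⟩, fun i => if i.1 = p.1.1 then letterSign (!c) else 0,
            fun i => (p.1.2, i.2), .stay, [(p, c)]⟩ with ha
        have hupd : a.update (UT.registers M) = UT.registers (letterVal (p, !c) * M) := by
          funext i
          exact (letterVal_mul_apply M p (!c) i.1 i.2).symm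
        have hM' := hM.letterVal_mul (p, !c)
        have hb' : 2 * (clearingBound r l.length (N + 1 + t) : ℤ) < b := by
          rwa [show N + 1 + t = N + (t + 1) by omega]
        rw [h2, List.append_cons]
        refine .of_step a ?_ rfl (min_eq_left hn) hupd rfl (fun i => ?_)
          (iht (N + 1) _ (out ++ [(p, c)]) (by omega) hM' hb')
        · have hsgn : decide (SignType.sign (UT.entry M p) = 1) = c := by
            simp only [hc, sign_eq_one_iff]
          simp [clearingTransducer, hs, ha, hsgn, h0]
        · have h3 := hM'.abs_apply_le i.1 i.2
          have h4 : (((N + 1 + 1) ^ r : ℕ) : ℤ) ≤ clearingBound r l.length (N + 1 + t) := by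
            exact_mod_cast (pow_le_clearingBound l.length (N + 1)).trans
              (clearingBound_mono _ (by omega))
          change 2 * |(letterVal (p, !c) * M).1.1 i.1 i.2| < b
          linarith
    intro N M out hM hb
    refine key _ N M out rfl hM (lt_of_le_of_lt ?_ hb)
    -- Initially `t` is at most `(N + 1) ^ r`, which is the increment in the recursion of
    -- `clearingBound`.
    have h1 := hM.abs_apply_le p.1.1 p.1.2
    have h2 : (UT.entry M p).natAbs ≤ (N + 1) ^ r := by
      rw [Int.abs_eq_natAbs] at h1
      exact_mod_cast h1
    have h3 : clearingBound r l.length (N + (UT.entry M p).natAbs) ≤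
        clearingBound r (p :: l).length N := clearingBound_mono _ (by omega)
    exact_mod_cast Nat.mul_le_mul_left 2 h3

open RegisterTransducer in
-- After the prefix `u` the registers hold its matrix; the head is at `u.length + 1` because
-- position 0 is the left end marker.
theorem haltsFrom_reading {w : List (UTLetter r)} {b : ℤ}
    (hb : 2 * (clearingBound r (pcPositions r).length w.length : ℤ) < b)
    (v : List (UTLetter r)) : ∀ u, w = u ++ v →
      HaltsFrom (clearingTransducer r) w (clearingWord (pcPositions r) (wordEval letterVal w)) b
        none (u.length + 1) (UT.registers (wordEval letterVal u)) [] := by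
  have hbound : ∀ u : List (UTLetter r), u.length ≤ w.length → ∀ i : Fin r × Fin r,
      2 * |UT.registers (wordEval letterVal u) i| < b := by
    intro u hu i
    have h1 := IsShortProduct.abs_apply_le ⟨u, hu, rfl⟩ i.1 i.2
    have h2 : (((w.length + 1) ^ r : ℕ) : ℤ) ≤
        clearingBound r (pcPositions r).length w.length := by
      exact_mod_cast pow_le_clearingBound _ _
    change 2 * |(wordEval letterVal u).1.1 i.1 i.2| < b
    linarith
  induction v with
  | nil =>
    intro u hu
    rw [List.append_nil] at hu
    subst hu
    set a : RegisterAction (UTLetter r) (Option (PendingPositions r)) (Fin r × Fin r) :=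
      ⟨some ⟨pcPositions r, List.suffix_refl _⟩, 0, id, .stay, []⟩ with ha
    have hupd : a.update (UT.registers (wordEval letterVal w)) =
        UT.registers (wordEval letterVal w) := by
      funext i
      simp [RegisterAction.update, ha]
    refine .of_step a ?_ rfl (min_eq_left le_rfl) hupd (List.append_nil _) (hbound w le_rfl)
      (haltsFrom_clearing w b _ le_rfl _ _ w.length _ [] ⟨w, le_rfl, rfl⟩ hb)
    simp [clearingTransducer, Transducer.inputAt, ha]
  | cons x v ih =>
    intro u hu
    obtain ⟨p, c⟩ := x
    set a : RegisterAction (UTLetter r) (Option (PendingPositions r)) (Fin r × Fin r) :=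
      ⟨none, fun i => if i.2 = p.1.2 then letterSign c else 0,
        fun i => (i.1, p.1.1), .right, []⟩ with ha
    have hlen : (u ++ [(p, c)]).length ≤ w.length := by simp [hu]
    have hupd : a.update (UT.registers (wordEval letterVal u)) =
        UT.registers (wordEval letterVal (u ++ [(p, c)])) := by
      funext i
      have h1 : wordEval letterVal (u ++ [(p, c)]) = wordEval letterVal u * letterVal (p, c) := by
        simp [wordEval]
      rw [h1]
      exact (mul_letterVal_apply _ p c i.1 i.2).symm
    refine .of_step a ?_ rfl ?_ hupd (List.append_nil _) (hbound _ hlen)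
      (ih (u ++ [(p, c)]) (by simp [hu]))
    · simp [clearingTransducer, Transducer.inputAt, ha, hu]
    · simp [ha, HeadMove.apply, hu]

open RegisterTransducer in
theorem haltsFrom_start {w : List (UTLetter r)} {b : ℤ}
    (hb : 2 * (clearingBound r (pcPositions r).length w.length : ℤ) < b) :
    HaltsFrom (clearingTransducer r) w (clearingWord (pcPositions r) (wordEval letterVal w)) b
      none 0 (fun i => ((clearingTransducer r).initial i : ℤ)) [] := by
  set a : RegisterAction (UTLetter r) (Option (PendingPositions r)) (Fin r × Fin r) :=
    ⟨none, 0, id, .right, []⟩ with ha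
  have hupd : a.update (fun i => ((clearingTransducer r).initial i : ℤ)) =
      UT.registers (wordEval letterVal []) := by
    funext i
    have h1 : UT.registers (wordEval (letterVal (r := r)) []) i =
        (1 : Matrix (Fin r) (Fin r) ℤ) i.1 i.2 := rfl
    rw [h1, Matrix.one_apply]
    simp only [RegisterAction.update, ha, clearingTransducer]
    split_ifs <;> simp
  refine .of_step a ?_ rfl (by simp [ha, HeadMove.apply]) hupd (List.append_nil _) (fun i => ?_)
    (haltsFrom_reading hb w [] rfl)
  · simp [clearingTransducer, Transducer.inputAt, ha]
  · have h1 := IsShortProduct.abs_apply_le (N := w.length) ⟨[], by simp, rfl⟩ i.1 i.2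
    have h2 : (((w.length + 1) ^ r : ℕ) : ℤ) ≤
        clearingBound r (pcPositions r).length w.length := by
      exact_mod_cast pow_le_clearingBound _ _
    change 2 * |(wordEval letterVal []).1.1 i.1 i.2| < b
    linarith

theorem logspaceComputable_clearingWord (r : ℕ) : LogspaceComputable
    fun w : List (UTLetter r) => clearingWord (pcPositions r) (wordEval letterVal w) := by
  obtain ⟨A, hA⟩ := exists_clearingBound_le_pow r (pcPositions r).length 1
  -- The simulation uses `A * (k + 2) + 1` digits and needs one more square than that, which is
  -- within `(2 * A + 2) * (k + 1)`.
  refine ⟨(clearingTransducer r).toTransducer, 2 * A + 2, fun w => ?_⟩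
  set k := Nat.log 2 w.length
  -- The base `w.length + 2` is at least 2 even for the empty word, as the polynomial bound
  -- requires.
  have hw : w.length + 2 ≤ 2 ^ (k + 2) := by
    have h1 : w.length < 2 ^ (k + 1) := Nat.lt_pow_succ_log_self (by norm_num) _
    have h2 : 2 ≤ 2 ^ (k + 1) := by rw [pow_succ]; have := Nat.one_le_two_pow (n := k); omega
    rw [pow_succ _ (k + 1)]
    omega
  have h1 : 2 * clearingBound r (pcPositions r).length w.length < 3 ^ (A * (k + 2) + 1) := by
    calc 2 * clearingBound r (pcPositions r).length w.length
        ≤ 2 * (2 ^ (k + 2)) ^ A := Nat.mul_le_mul_left 2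
          ((hA (w.length + 2) w.length (by omega) (by rw [pow_one]; omega)).trans (Nat.pow_le_pow_left hw A))
      _ = 2 ^ (A * (k + 2) + 1) := by rw [← pow_mul, pow_succ, mul_comm, mul_comm A]
      _ < 3 ^ (A * (k + 2) + 1) := Nat.pow_lt_pow_left (by norm_num) (by omega)
  refine RegisterTransducer.HaltsFrom.computesInSpace (K := A * (k + 2) + 1) ?_ (by omega)
    (haltsFrom_start (by exact_mod_cast h1))
  nlinarith [Nat.zero_le (A * k)]

end Machine

theorem mainTheorem6 (r : ℕ) (hr : 2 ≤ r) :
    IsPolycyclicGeneratingSequence ((pcPositions r).map elemMatrix) ∧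
    IsNormalForm (letterVal (r := r)) (pcNormalForm r) ∧
    ∃ g : List (UTLetter r) → List (UTLetter r),
      IsNormalFormFunction letterVal (pcNormalForm r) g ∧ LogspaceComputable g :=
  ⟨isPolycyclicGeneratingSequence_elemMatrix r, isNormalForm_pcNormalForm r,
    fun w => clearingWord (pcPositions r) (wordEval letterVal w),
    fun _ => ⟨clearingWord_mem_pcNormalForm _, wordEval_clearingWord_pcPositions _⟩,
    logspaceComputable_clearingWord r⟩
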